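/- Let $\mathbb D$ be the open unit disk in $\mathbb C$, $dA$ the area measure on $\mathbb D$, and $d\tau(z)=dA(z)/(1-|z|^2)^2$. Let $\mu$ be a nonzero finite positive Borel measure on the unit circle $\partial\mathbb D$, and let $$P_\mu(z)=\frac1{2\pi}\int_{\partial\mathbb D}\frac{1-|z|^2}{|\zeta-z|^2}\,d\mu(\zeta),\qquad z\in\mathbb D.$$ The Dirichlet-type space $D(\mu)$ is the space of all analytic functions $f$ on $\mathbb D$ with $\int_{\mathbb D}|f'(z)|^2P_\mu(z)\,dA(z)<\infty$, and the Bergman space $A^2$ is the space of all analytic functions $f$ on $\mathbb D$ with $\int_{\mathbb D}|f|^2\,dA<\infty$. For $z,w\in\mathbb D$ let $\varphi_z(w)=\frac{z-w}{1-\bar z w}$ and $d(z,w)=\log\frac{1+|\varphi_z(w)|}{1-|\varphi_z(w)|}$ (the Bergman metric). For $r>0$ let $B(z,r)=\{w\in\mathbb D: d(z,w)<r\}$ and let $|B(z,r)|$ be its area. For $f\in A^2$ put $$MOf(z)=\Big(\int_{\mathbb D}|f(\varphi_z(w))-f(z)|^2\,dA(w)\Big)^{1/2},$$ $$\hat f_r(z)=\frac1{|B(z,r)|}\int_{B(z,r)}f\,dA,\qquad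 MO_rf(z)=\Big(\frac1{|B(z,r)|}\int_{B(z,r)}|f(w)-\hat f_r(z)|^2\,dA(w)\Big)^{1/2}.$$ **Theorem 3.4.** Let $f\in A^2$ and let $r>0$ be any fixed radius. Then the following statements are equivalent: (i) $f\in D(\mu)$; (ii) $\displaystyle\int_{\mathbb D}\big(MOf(z)\big)^2P_\mu(z)\,d\tau(z)<\infty$; (iii) $\displaystyle\int_{\mathbb D}\big(MO_rf(z)\big)^2P_\mu(z)\,d\tau(z)<\infty$. -/

import Mathlib

open MeasureTheory
open scoped ENNReal

namespace DirichletType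

noncomputable section

/-- The area measure `dA` on the open unit disk `𝔻`. -/
def diskArea : Measure ℂ := volume.restrict (Metric.ball (0 : ℂ) 1)

/-- The Möbius-invariant measure `dτ(z) = dA(z) / (1 - |z|²)²` on the unit disk. -/
def diskTau : Measure ℂ :=
  diskArea.withDensity fun z => ENNReal.ofReal (1 / (1 - ‖z‖ ^ 2) ^ 2)

/-- The Poisson integral `P_μ(z) = (1/2π) ∫ (1 - |z|²) / |ζ - z|² dμ(ζ)`, for `z` in the unit disk,
of a (positive) Borel measure `μ` on the unit circle. The integrand is positive for `|z| < 1`;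
for finite `μ` the value is finite there. -/
def poissonIntegral (μ : Measure (Metric.sphere (0 : ℂ) 1)) (z : ℂ) : ℝ≥0∞ :=
  (∫⁻ ζ : Metric.sphere (0 : ℂ) 1, ENNReal.ofReal ((1 - ‖z‖ ^ 2) / ‖(ζ : ℂ) - z‖ ^ 2) ∂μ) /
    ENNReal.ofReal (2 * Real.pi)

/-- `f` belongs to the Dirichlet-type space `D(μ)`, for a nonzero measure `μ` on the circle:
`f` is analytic on the unit disk and `∫ |f'|² P_μ dA < ∞`. -/
def MemDirichlet (μ : Measure (Metric.sphere (0 : ℂ) 1)) (f : ℂ → ℂ) : Prop :=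
  DifferentiableOn ℂ f (Metric.ball 0 1) ∧
    ∫⁻ z, ‖deriv f z‖ₑ ^ 2 * poissonIntegral μ z ∂diskArea < ∞

/-- `f` belongs to the Bergman space `A²`: `f` is analytic on the unit disk and
`∫ |f|² dA < ∞`. -/
def MemBergman (f : ℂ → ℂ) : Prop :=
  DifferentiableOn ℂ f (Metric.ball 0 1) ∧ ∫⁻ z, ‖f z‖ₑ ^ 2 ∂diskArea < ∞

/-- The Möbius map `φ_z(w) = (z - w) / (1 - z̄ w)`. -/
def mobius (z w : ℂ) : ℂ := (z - w) / (1 - (starRingEnd ℂ) z * w)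

/-- The Bergman metric `d(z, w) = log ((1 + |φ_z(w)|) / (1 - |φ_z(w)|))` on the unit disk. -/
def bergmanDist (z w : ℂ) : ℝ := Real.log ((1 + ‖mobius z w‖) / (1 - ‖mobius z w‖))

/-- The Bergman ball `B(z, R) = {w ∈ 𝔻 : d(z, w) < R}`. -/
def bergmanBall (z : ℂ) (R : ℝ) : Set ℂ := {w | w ∈ Metric.ball (0 : ℂ) 1 ∧ bergmanDist z w < R}

/-- The mean oscillation `MO f(z) = (∫ |f(φ_z(w)) - f(z)|² dA(w))^{1/2}`. -/
def meanOsc (f : ℂ → ℂ) (z : ℂ) : ℝ≥0∞ :=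
  (∫⁻ w, ‖f (mobius z w) - f z‖ₑ ^ 2 ∂diskArea) ^ (1 / 2 : ℝ)

/-- The average `f̂_r(z) = |B(z, r)|⁻¹ ∫_{B(z, r)} f dA` of `f` over a Bergman ball. -/
def ballAverage (r : ℝ) (f : ℂ → ℂ) (z : ℂ) : ℂ := ⨍ w in bergmanBall z r, f w

/-- The mean oscillation in the Bergman metric,
`MO_r f(z) = (|B(z, r)|⁻¹ ∫_{B(z, r)} |f(w) - f̂_r(z)|² dA(w))^{1/2}`. -/
def meanOscBall (r : ℝ) (f : ℂ → ℂ) (z : ℂ) : ℝ≥0∞ :=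
  ((∫⁻ w in bergmanBall z r, ‖f w - ballAverage r f z‖ₑ ^ 2) / volume (bergmanBall z r)) ^
    (1 / 2 : ℝ)

end

end DirichletType

/-!
Write `φ_z` for the involutive Möbius map exchanging `0` and `z`. The theorem compares all three
conditions through the functions `f ∘ φ_z`.

*(i) implies (ii).* The Littlewood–Paley inequality `lintegral_sq_enorm_sub_le`, a comparison of
Taylor coefficients, bounds `MO f(z)²` by a multiple of `∫ |(f ∘ φ_z)'(w)|² (1 - |w|²)² dA(w)`,
which after the substitution `u = φ_z(w)` is `∫ |f'(u)|² (1 - |φ_z(u)|²)² dA(u)`. Integrating against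
`P_μ dτ` and exchanging the integrals leaves, for each `u`, the integral
`∫ (1 - |φ_z(u)|²)² P_μ(z) dτ(z)`. Since `1 - |φ_z(u)|² = |φ_u'(z)| (1 - |z|²)`, this is
`∫ P_μ(φ_u(w)) dA(w)`, and it equals `π P_μ(u)` because `P_μ ∘ φ_u` is harmonic
(`lintegral_poissonIntegral_comp_mobius`).

*(ii) implies (iii).* The ball `B(z, r)` is the image under `φ_z` of the Euclidean disk `B(0, s)`
with `s = tanh (r / 2)`, and on `B(0, s)` the derivative of `φ_z` is comparable to `1 - |z|²`. Averages
over `B(z, r)` thus amount to averages over `B(0, s)` of functions composed with `φ_z`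
(`lintegral_image_mobius_div_volume`), which gives the pointwise bound `MO_r f ≤ C · MO f`.

*(iii) implies (i).* By Parseval's identity, `|g'(0)|²` is at most a constant times
`∫_{B(0, s)} |g - c|² dA` for any constant `c` (`sq_enorm_deriv_zero_le`). For `g = f ∘ φ_z` this
reads `(1 - |z|²)² |f'(z)|² ≤ C · MO_r f(z)²`; now integrate against `P_μ dτ`.
-/

namespace DirichletType

open Set Filter Metric Topology
open scoped Real ComplexConjugate

/-! ### Integration in polar coordinates -/

lemma lintegral_circleMap_eq_circleAverage {u : ℂ → ℝ} {ρ : ℝ} (hu : ContinuousOn u (sphere 0 |ρ|))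
    (h0 : ∀ z ∈ sphere 0 |ρ|, 0 ≤ u z) :
    ∫⁻ θ in Ioo (-π) π, ENNReal.ofReal (u (circleMap 0 ρ θ)) =
      ENNReal.ofReal (2 * π * Real.circleAverage u 0 ρ) := by
  have hcont : Continuous fun θ : ℝ => u (circleMap 0 ρ θ) := by
    rw [← continuousOn_univ]
    exact hu.comp (continuous_circleMap 0 ρ).continuousOn fun θ _ => circleMap_mem_sphere' 0 ρ θ
  have hper : (fun θ => u (circleMap 0 ρ θ)).Periodic (2 * π) :=
    fun x => by simp [periodic_circleMap 0 ρ x]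
  have h1 : Real.circleAverage u 0 ρ = (2 * π)⁻¹ * ∫ θ in (-π)..π, u (circleMap 0 ρ θ) := by
    have := hper.intervalIntegral_add_eq 0 (-π)
    rw [Real.circleAverage_def, smul_eq_mul]
    rw [zero_add, show -π + 2 * π = π by ring] at this
    rw [this]
  rw [h1, mul_inv_cancel_left₀ (by positivity),
    intervalIntegral.integral_of_le (by linarith [Real.pi_pos]), integral_Ioc_eq_integral_Ioo,
    ofReal_integral_eq_lintegral_ofReal]
  · exact (hcont.integrableOn_Icc (a := -π) (b := π)).mono_set Ioo_subset_Icc_self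
  · exact Eventually.of_forall fun θ => h0 _ (circleMap_mem_sphere' 0 ρ θ)

/-- Integration over a disk from the integrals `m ρ` over the circles. The function need only be
continuous on the open disk, so that functions that are arbitrary outside the unit disk qualify. -/
lemma lintegral_ball_eq_of_circle {F : ℂ → ℝ≥0∞} {s : ℝ} (hF : ContinuousOn F (ball 0 s))
    {m : ℝ → ℝ≥0∞} (hm : ∀ ρ ∈ Ioo 0 s, ∫⁻ θ in Ioo (-π) π, F (circleMap 0 ρ θ) = m ρ) :
    ∫⁻ w in ball (0 : ℂ) s, F w = ∫⁻ ρ in Ioo 0 s, ENNReal.ofReal ρ * m ρ := by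
  classical
  -- Extending by zero makes the integrand measurable on the whole plane, as polar coordinates need.
  set G : ℂ → ℝ≥0∞ := (ball (0 : ℂ) s).indicator F with hG
  have hGm : Measurable G := by
    rw [hG, ← piecewise_eq_indicator]
    exact hF.measurable_piecewise continuousOn_const measurableSet_ball
  have hsymm : ∀ p : ℝ × ℝ, Complex.polarCoord.symm p = circleMap 0 p.1 p.2 := fun p => by
    rw [Complex.polarCoord_symm_apply, circleMap, zero_add, Complex.exp_mul_I,
      Complex.ofReal_cos, Complex.ofReal_sin]
  rw [← lintegral_indicator measurableSet_ball, ← hG, ← Complex.lintegral_comp_polarCoord_symm,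
    polarCoord_target, Measure.volume_eq_prod, ← Measure.prod_restrict]
  simp_rw [hsymm, smul_eq_mul]
  have hcm : Measurable fun p : ℝ × ℝ => circleMap 0 p.1 p.2 := by
    unfold circleMap; fun_prop
  rw [lintegral_prod _ (by exact (measurable_fst.ennreal_ofReal.mul (hGm.comp hcm)).aemeasurable)]
  have hsub : Ioo 0 s ⊆ Ioi (0 : ℝ) := Ioo_subset_Ioi_self
  have hzero : ∀ ρ ∈ Ioi (0 : ℝ), ∫⁻ θ in Ioo (-π) π, ENNReal.ofReal ρ * G (circleMap 0 ρ θ) =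
      (Ioo 0 s).indicator (fun ρ => ENNReal.ofReal ρ * m ρ) ρ := by
    intro ρ hρ
    have hρ' : (0 : ℝ) < ρ := hρ
    rw [lintegral_const_mul _ (by exact hGm.comp (measurable_circleMap 0 ρ))]
    by_cases h : ρ < s
    · have hmem : ρ ∈ Ioo 0 s := ⟨hρ, h⟩
      rw [indicator_of_mem hmem, ← hm ρ hmem]
      congr 1
      refine lintegral_congr fun θ => indicator_of_mem ?_ _
      simpa [abs_of_pos hρ'] using h
    · rw [indicator_of_notMem (by simp [h])]
      have : ∀ θ, G (circleMap 0 ρ θ) = 0 := fun θ => indicator_of_notMem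
        (by simpa [abs_of_pos hρ'] using h) _
      simp [this]
  rw [setLIntegral_congr_fun measurableSet_Ioi hzero, lintegral_indicator measurableSet_Ioo,
    Measure.restrict_restrict measurableSet_Ioo, inter_eq_left.mpr hsub]

/-! ### Parseval's identity for power series -/

/-- The partial sums are polynomials, for which the identity is known, and they are dominated on
the unit circle by the sum of the absolute values of the coefficients. -/
lemma hasSum_sq_norm_coeff_eq_circleAverage {c : ℕ → ℂ} {g : ℂ → ℂ} (hc : Summable fun n => ‖c n‖)
    (hg : ∀ z ∈ sphere (0 : ℂ) 1, HasSum (fun n => c n * z ^ n) (g z)) :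
    HasSum (fun n => ‖c n‖ ^ 2) (Real.circleAverage (fun z => ‖g z‖ ^ 2) 0 1) := by
  rw [hasSum_iff_tendsto_nat_of_nonneg fun n => by positivity]
  -- The partial sums of the power series.
  let p : ℕ → Polynomial ℂ := fun N => ∑ n ∈ Finset.range N, Polynomial.monomial n (c n)
  have hcoeff : ∀ N n, (p N).coeff n = if n < N then c n else 0 := by
    intro N n
    simp [p, Polynomial.coeff_monomial]
  have heval : ∀ N z, (p N).eval z = ∑ n ∈ Finset.range N, c n * z ^ n := by
    intro N z
    simp [p, Polynomial.eval_finsetSum]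
  have hp : ∀ N, ∑ n ∈ Finset.range N, ‖c n‖ ^ 2 =
      Real.circleAverage (fun z => ‖(p N).eval z‖ ^ 2) 0 1 := by
    intro N
    rw [← Polynomial.sum_sq_norm_coeff_eq_circleAverage]
    symm
    apply Finset.sum_subset_zero_on_sdiff
    · intro n hn
      by_contra h
      rw [Finset.mem_range] at h
      simp [hcoeff, h] at hn
    · intro n hn
      have := (Finset.mem_sdiff.mp hn)
      rw [Finset.mem_range, Polynomial.notMem_support_iff, hcoeff] at this
      rw [if_pos this.1] at this
      simp [this.2]
    · intro n hn
      rw [Polynomial.mem_support_iff, hcoeff] at hn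
      rw [hcoeff, if_pos (by by_contra h; simp [h] at hn)]
  simp_rw [hp, Real.circleAverage_def]
  refine Tendsto.const_smul ?_ _
  have hbd : ∀ N (θ : ℝ), ‖(p N).eval (circleMap 0 1 θ)‖ ≤ ∑' n, ‖c n‖ := by
    intro N θ
    rw [heval]
    refine (norm_sum_le _ _).trans ?_
    simp only [norm_mul, norm_pow, norm_circleMap_zero, abs_one, one_pow, mul_one]
    exact hc.sum_le_tsum _ fun _ _ => norm_nonneg _
  refine intervalIntegral.tendsto_integral_filter_of_dominated_convergence
    (fun _ => (∑' n, ‖c n‖) ^ 2) ?_ ?_ ?_ ?_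
  · refine Eventually.of_forall fun N => Continuous.aestronglyMeasurable ?_
    exact ((p N).continuous.comp (continuous_circleMap 0 1)).norm.pow 2
  · refine Eventually.of_forall fun N => Eventually.of_forall fun θ _ => ?_
    rw [Real.norm_of_nonneg (by positivity)]
    exact pow_le_pow_left₀ (norm_nonneg _) (hbd N θ) 2
  · exact intervalIntegrable_const
  · refine Eventually.of_forall fun θ _ => ?_
    have := (hg (circleMap 0 1 θ) (circleMap_mem_sphere 0 zero_le_one θ)).tendsto_sum_nat
    simp_rw [← heval] at this
    exact (this.norm.pow 2)

lemma summable_norm_mul_pow {a : ℕ → ℂ} {g : ℂ → ℂ}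
    (hg : ∀ z ∈ ball (0 : ℂ) 1, HasSum (fun n => a n * z ^ n) (g z)) {ρ : ℝ} (hρ : ρ ∈ Ioo 0 1) :
    Summable fun n => ‖a n * (ρ : ℂ) ^ n‖ :=
  (hg ρ (by simpa [abs_of_pos hρ.1] using hρ.2)).summable.norm

lemma lintegral_circleMap_sq_enorm {a : ℕ → ℂ} {g : ℂ → ℂ}
    (hg : ∀ z ∈ ball (0 : ℂ) 1, HasSum (fun n => a n * z ^ n) (g z))
    (hcont : ContinuousOn g (ball 0 1)) {ρ : ℝ} (hρ : ρ ∈ Ioo 0 1) :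
    ∫⁻ θ in Ioo (-π) π, ‖g (circleMap 0 ρ θ)‖ₑ ^ 2 =
      ENNReal.ofReal (2 * π) * ∑' n, ‖a n‖ₑ ^ 2 * ENNReal.ofReal (ρ ^ (2 * n)) := by
  have hsub : sphere (0 : ℂ) |ρ| ⊆ ball 0 1 := by
    rw [abs_of_pos hρ.1]; exact sphere_subset_ball hρ.2
  have h1 : ∀ θ, ‖g (circleMap 0 ρ θ)‖ₑ ^ 2 = ENNReal.ofReal (‖g (circleMap 0 ρ θ)‖ ^ 2) := by
    intro θ
    rw [← ofReal_norm, ENNReal.ofReal_pow (norm_nonneg _)]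
  simp_rw [h1]
  rw [lintegral_circleMap_eq_circleAverage (u := fun z => ‖g z‖ ^ 2)
    ((hcont.mono hsub).norm.pow 2) (fun _ _ => by positivity),
    ENNReal.ofReal_mul (by positivity)]
  congr 1
  have h2 : Real.circleAverage (fun z => ‖g z‖ ^ 2) 0 ρ =
      Real.circleAverage (fun z => ‖g (ρ * z)‖ ^ 2) 0 1 := by
    rw [Real.circleAverage_eq_circleAverage_zero_one]
    simp
  have h3 := hasSum_sq_norm_coeff_eq_circleAverage (summable_norm_mul_pow hg hρ)
    (g := fun z => g (ρ * z)) (fun z hz => by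
      have hz1 : ‖z‖ = 1 := by simpa using hz
      have := hg (ρ * z) (by simpa [abs_of_pos hρ.1, hz1] using hρ.2)
      simpa [mul_pow, mul_assoc] using this)
  rw [h2, ← h3.tsum_eq, ENNReal.ofReal_tsum_of_nonneg (fun n => by positivity) h3.summable]
  refine tsum_congr fun n => ?_
  rw [norm_mul, mul_pow, ENNReal.ofReal_mul (by positivity), ENNReal.ofReal_pow (norm_nonneg _),
    ofReal_norm, norm_pow, Complex.norm_real, Real.norm_of_nonneg hρ.1.le, ← pow_mul,
    mul_comm n]

/-- Parseval's identity for a radial weight: monomials are orthogonal, and the weight of `|aₙ|²` is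
`2π` times the moment of order `2n + 1` of the weight. -/
lemma lintegral_ball_sq_enorm_mul {a : ℕ → ℂ} {g : ℂ → ℂ}
    (hg : ∀ z ∈ ball (0 : ℂ) 1, HasSum (fun n => a n * z ^ n) (g z))
    (hcont : ContinuousOn g (ball 0 1)) {s : ℝ} (hs : s ≤ 1) {φ : ℝ → ℝ} (hφ : Continuous φ) :
    ∫⁻ w in ball (0 : ℂ) s, ‖g w‖ₑ ^ 2 * ENNReal.ofReal (φ ‖w‖) =
      ENNReal.ofReal (2 * π) *
        ∑' n, ‖a n‖ₑ ^ 2 * ∫⁻ ρ in Ioo 0 s, ENNReal.ofReal (ρ ^ (2 * n + 1) * φ ρ) := by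
  have hc : ContinuousOn (fun w : ℂ => ‖g w‖ₑ ^ 2 * ENNReal.ofReal (φ ‖w‖)) (ball 0 s) := by
    have h1 : ContinuousOn (fun w : ℂ => ‖g w‖ * ‖g w‖ * φ ‖w‖) (ball 0 s) := by
      have := hcont.mono (ball_subset_ball hs)
      exact (this.norm.mul this.norm).mul (by fun_prop)
    refine (ENNReal.continuous_ofReal.comp_continuousOn h1).congr fun w _ => ?_
    simp only [Function.comp]
    rw [ENNReal.ofReal_mul (by positivity), ENNReal.ofReal_mul (by positivity),
      ofReal_norm, sq]
  rw [lintegral_ball_eq_of_circle hc (m := fun ρ => (ENNReal.ofReal (2 * π) *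
    ∑' n, ‖a n‖ₑ ^ 2 * ENNReal.ofReal (ρ ^ (2 * n))) * ENNReal.ofReal (φ ρ))]
  · have : ∀ ρ ∈ Ioo 0 s, ENNReal.ofReal ρ * ((ENNReal.ofReal (2 * π) *
        ∑' n, ‖a n‖ₑ ^ 2 * ENNReal.ofReal (ρ ^ (2 * n))) * ENNReal.ofReal (φ ρ)) =
        ENNReal.ofReal (2 * π) *
          ∑' n, ‖a n‖ₑ ^ 2 * ENNReal.ofReal (ρ ^ (2 * n + 1) * φ ρ) := by
      intro ρ hρ
      rw [show ∀ x y z w : ℝ≥0∞, x * (y * z * w) = y * (z * (x * w)) by intros; ring,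
        ← ENNReal.tsum_mul_right]
      congr 1
      refine tsum_congr fun n => ?_
      have hρ0 : 0 ≤ ρ := hρ.1.le
      rw [pow_succ ρ, ENNReal.ofReal_mul (by positivity), ENNReal.ofReal_mul (by positivity)]
      ring
    rw [setLIntegral_congr_fun measurableSet_Ioo this, lintegral_const_mul' _ _ (by finiteness),
      lintegral_tsum (fun n => by fun_prop)]
    congr 1
    refine tsum_congr fun n => ?_
    rw [lintegral_const_mul' _ _ (by finiteness)]
  · intro ρ hρ
    have hρ1 : ρ ∈ Ioo 0 1 := ⟨hρ.1, hρ.2.trans_le hs⟩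
    simp_rw [norm_circleMap_zero, abs_of_pos hρ.1]
    rw [lintegral_mul_const' _ _ (by finiteness), lintegral_circleMap_sq_enorm hg hcont hρ1]

lemma lintegral_Ioo_ofReal {s I : ℝ} (hs : 0 ≤ s) {ψ : ℝ → ℝ} (hψ : Continuous ψ)
    (h0 : ∀ x ∈ Ioo 0 s, 0 ≤ ψ x) (hI : ∫ x in (0 : ℝ)..s, ψ x = I) :
    ∫⁻ ρ in Ioo 0 s, ENNReal.ofReal (ψ ρ) = ENNReal.ofReal I := by
  rw [← hI, intervalIntegral.integral_of_le hs, integral_Ioc_eq_integral_Ioo,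
    ofReal_integral_eq_lintegral_ofReal]
  · exact (hψ.integrableOn_Icc (a := 0) (b := s)).mono_set Ioo_subset_Icc_self
  · exact (ae_restrict_iff' measurableSet_Ioo).mpr (Eventually.of_forall h0)

lemma lintegral_Ioo_pow {s : ℝ} (hs : 0 ≤ s) (n : ℕ) :
    ∫⁻ ρ in Ioo 0 s, ENNReal.ofReal (ρ ^ (2 * n + 1)) =
      ENNReal.ofReal (s ^ (2 * n + 2) / (2 * n + 2)) := by
  refine lintegral_Ioo_ofReal hs (by fun_prop) (fun x hx => pow_nonneg hx.1.le _) ?_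
  rw [integral_pow]
  push_cast
  simp
  ring

lemma lintegral_Ioo_pow_mul_sq (n : ℕ) :
    ∫⁻ ρ in Ioo (0 : ℝ) 1, ENNReal.ofReal (ρ ^ (2 * n + 1) * (1 - ρ ^ 2) ^ 2) =
      ENNReal.ofReal (1 / ((n + 1) * (n + 2) * (n + 3))) := by
  refine lintegral_Ioo_ofReal zero_le_one (by fun_prop)
    (fun x hx => mul_nonneg (pow_nonneg hx.1.le _) (sq_nonneg _)) ?_
  have : ∀ ρ : ℝ, ρ ^ (2 * n + 1) * (1 - ρ ^ 2) ^ 2 =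
      ρ ^ (2 * n + 1) - 2 * ρ ^ (2 * n + 3) + ρ ^ (2 * n + 5) := fun ρ => by ring
  simp_rw [this]
  rw [intervalIntegral.integral_add (Continuous.intervalIntegrable (by fun_prop) _ _)
    (Continuous.intervalIntegrable (by fun_prop) _ _),
    intervalIntegral.integral_sub (Continuous.intervalIntegrable (by fun_prop) _ _)
    (Continuous.intervalIntegrable (by fun_prop) _ _), intervalIntegral.integral_const_mul,
    integral_pow, integral_pow, integral_pow]
  push_cast
  simp only [one_pow]
  rw [zero_pow (by omega), zero_pow (by omega), zero_pow (by omega)]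
  field_simp
  ring

/-! ### Two estimates for derivatives of analytic functions on the disk -/

/-- The `n`-th Taylor coefficient `g⁽ⁿ⁾(0) / n!` of `g` at `0`. -/
noncomputable def taylorCoeff (g : ℂ → ℂ) (n : ℕ) : ℂ := (n.factorial : ℂ)⁻¹ * iteratedDeriv n g 0

lemma hasSum_taylorCoeff {g : ℂ → ℂ} (hg : DifferentiableOn ℂ g (ball 0 1)) :
    ∀ z ∈ ball (0 : ℂ) 1, HasSum (fun n => taylorCoeff g n * z ^ n) (g z) := by
  intro z hz
  have h : (fun n => taylorCoeff g n * z ^ n) =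
      fun n : ℕ => (n.factorial : ℂ)⁻¹ • (z - 0) ^ n • iteratedDeriv n g 0 := by
    funext n
    simp only [taylorCoeff, sub_zero, smul_eq_mul]
    ring
  rw [h]
  exact Complex.hasSum_taylorSeries_on_ball hg hz

lemma taylorCoeff_deriv (g : ℂ → ℂ) (n : ℕ) :
    taylorCoeff (deriv g) n = (n + 1) * taylorCoeff g (n + 1) := by
  rw [taylorCoeff, taylorCoeff, ← iteratedDeriv_succ', Nat.factorial_succ]
  push_cast
  have : (n : ℂ) + 1 ≠ 0 := Nat.cast_add_one_ne_zero n
  field_simp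

lemma taylorCoeff_sub_const {g : ℂ → ℂ} (hg : DifferentiableOn ℂ g (ball 0 1)) (c : ℂ) :
    ∀ z ∈ ball (0 : ℂ) 1,
      HasSum (fun n => (if n = 0 then g 0 - c else taylorCoeff g n) * z ^ n) (g z - c) := by
  intro z hz
  have h : (fun n => (if n = 0 then g 0 - c else taylorCoeff g n) * z ^ n) =
      fun n => taylorCoeff g n * z ^ n - if n = 0 then c else 0 := by
    funext n
    by_cases hn : n = 0
    · simp [hn, taylorCoeff]
    · simp [hn]
  rw [h]
  exact (hasSum_taylorCoeff hg z hz).sub (hasSum_ite_eq 0 c)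

/-- A Littlewood–Paley inequality. Both sides are sums over the Taylor coefficients `aₙ`, `n ≥ 1`,
of `g`: the weights of `|aₙ|²` are `π / (n + 1)` on the left and `2πn / ((n + 1)(n + 2))` in
the integral on the right. -/
lemma lintegral_sq_enorm_sub_le {g : ℂ → ℂ} (hg : DifferentiableOn ℂ g (ball 0 1)) :
    ∫⁻ w in ball (0 : ℂ) 1, ‖g w - g 0‖ₑ ^ 2 ≤ ENNReal.ofReal (3 / 2) *
      ∫⁻ w in ball (0 : ℂ) 1, ‖deriv g w‖ₑ ^ 2 * ENNReal.ofReal ((1 - ‖w‖ ^ 2) ^ 2) := by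
  have h1 := lintegral_ball_sq_enorm_mul (taylorCoeff_sub_const hg (g 0))
    (hg.continuousOn.sub continuousOn_const) le_rfl (φ := fun _ => 1) continuous_const
  have hd := hg.deriv isOpen_ball
  have h2 := lintegral_ball_sq_enorm_mul (hasSum_taylorCoeff hd) hd.continuousOn le_rfl
    (φ := fun x => (1 - x ^ 2) ^ 2) (by fun_prop)
  simp only [ENNReal.ofReal_one, mul_one] at h1
  rw [h1, h2, mul_left_comm]
  gcongr
  simp_rw [lintegral_Ioo_pow_mul_sq, lintegral_Ioo_pow zero_le_one, ← ENNReal.tsum_mul_left]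
  rw [tsum_eq_zero_add' ENNReal.summable]
  simp only [sub_self, if_true, enorm_zero, Nat.add_eq_zero_iff, one_ne_zero, and_false, if_false]
  rw [zero_pow two_ne_zero, zero_mul, zero_add]
  refine ENNReal.tsum_le_tsum fun n => ?_
  rw [taylorCoeff_deriv, enorm_mul, mul_pow, mul_left_comm, mul_comm (‖(n : ℂ) + 1‖ₑ ^ 2), mul_assoc]
  gcongr
  have : ‖(n : ℂ) + 1‖ₑ ^ 2 = ENNReal.ofReal ((n + 1) ^ 2) := by
    rw [← ofReal_norm, ← ENNReal.ofReal_pow (norm_nonneg _)]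
    congr 2
    exact_mod_cast Complex.norm_natCast (n + 1)
  rw [this, ← ENNReal.ofReal_mul (by positivity), ← ENNReal.ofReal_mul (by positivity)]
  apply ENNReal.ofReal_le_ofReal
  push_cast
  rw [one_pow, mul_left_comm, div_le_iff₀ (by positivity)]
  have hn : (0 : ℝ) ≤ n := Nat.cast_nonneg n
  field_simp
  nlinarith

/-- The right-hand side is a sum over the Taylor coefficients of `g - c`; the left-hand side is the
term of the coefficient `g'(0)`, which does not depend on `c`. -/
lemma sq_enorm_deriv_zero_le {g : ℂ → ℂ} (hg : DifferentiableOn ℂ g (ball 0 1)) (c : ℂ) {s : ℝ}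
    (hs0 : 0 ≤ s) (hs : s ≤ 1) :
    ENNReal.ofReal (π * s ^ 4 / 2) * ‖deriv g 0‖ₑ ^ 2 ≤
      ∫⁻ w in ball (0 : ℂ) s, ‖g w - c‖ₑ ^ 2 := by
  have h1 := lintegral_ball_sq_enorm_mul (taylorCoeff_sub_const hg c)
    (hg.continuousOn.sub continuousOn_const) hs (φ := fun _ => 1) continuous_const
  simp only [ENNReal.ofReal_one, mul_one] at h1
  rw [h1]
  simp_rw [lintegral_Ioo_pow hs0]
  refine le_trans (le_of_eq ?_) (mul_le_mul_right (ENNReal.le_tsum 1) _)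
  have : taylorCoeff g 1 = deriv g 0 := by simp [taylorCoeff]
  rw [if_neg one_ne_zero, this, mul_left_comm, ← ENNReal.ofReal_mul (by positivity), mul_comm]
  congr 2
  push_cast
  ring

/-! ### Möbius maps of the disk -/

lemma one_sub_conj_mul_ne_zero {z w : ℂ} (hz : ‖z‖ < 1) (hw : ‖w‖ ≤ 1) : 1 - conj z * w ≠ 0 := by
  intro h
  have h1 : ‖conj z * w‖ = 1 := by rw [← sub_eq_zero.mp h, norm_one]
  rw [norm_mul, RCLike.norm_conj] at h1
  nlinarith [norm_nonneg z, norm_nonneg w]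

/-- The absolute value `(1 - |z|²) / |1 - z̄ w|²` of the derivative of `φ_z` at `w`. -/
noncomputable def mobiusScale (z w : ℂ) : ℝ := (1 - ‖z‖ ^ 2) / ‖1 - conj z * w‖ ^ 2

lemma norm_one_sub_conj_mul_comm (z w : ℂ) : ‖1 - conj z * w‖ = ‖1 - conj w * z‖ := by
  rw [← RCLike.norm_conj (1 - conj z * w)]
  simp [mul_comm]

lemma norm_mobius_comm (z w : ℂ) : ‖mobius z w‖ = ‖mobius w z‖ := by
  rw [mobius, mobius, norm_div, norm_div, norm_one_sub_conj_mul_comm, norm_sub_rev]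

lemma one_sub_sq_norm_mobius {z w : ℂ} (hz : ‖z‖ < 1) (hw : ‖w‖ ≤ 1) :
    1 - ‖mobius z w‖ ^ 2 = mobiusScale z w * (1 - ‖w‖ ^ 2) := by
  have h := one_sub_conj_mul_ne_zero hz hw
  have h' : ‖1 - conj z * w‖ ^ 2 ≠ 0 := by simpa using h
  rw [mobius, mobiusScale, norm_div, div_pow, one_sub_div h', div_mul_eq_mul_div]
  congr 1
  simp only [Complex.sq_norm, Complex.normSq_apply, Complex.sub_re, Complex.sub_im, Complex.mul_re,
    Complex.mul_im, Complex.conj_re, Complex.conj_im, Complex.one_re, Complex.one_im]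
  ring

lemma mobiusScale_pos {z w : ℂ} (hz : ‖z‖ < 1) (hw : ‖w‖ ≤ 1) : 0 < mobiusScale z w := by
  have h := one_sub_conj_mul_ne_zero hz hw
  have : ‖z‖ ^ 2 < 1 := by nlinarith [norm_nonneg z]
  exact div_pos (by linarith) (by positivity)

lemma one_sub_sq_norm_pos {z : ℂ} (hz : ‖z‖ < 1) : 0 < 1 - ‖z‖ ^ 2 := by
  nlinarith [norm_nonneg z]

lemma norm_mobius_lt_one {z w : ℂ} (hz : ‖z‖ < 1) (hw : ‖w‖ < 1) : ‖mobius z w‖ < 1 := by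
  have h1 := one_sub_sq_norm_mobius hz hw.le
  have h2 := mobiusScale_pos hz hw.le
  have h3 : ‖w‖ ^ 2 < 1 := by nlinarith [norm_nonneg w]
  have h4 : 0 < mobiusScale z w * (1 - ‖w‖ ^ 2) := mul_pos h2 (by linarith)
  nlinarith [norm_nonneg (mobius z w)]

lemma mobius_mobius {z w : ℂ} (hz : ‖z‖ < 1) (hw : ‖w‖ ≤ 1) : mobius z (mobius z w) = w := by
  have h := one_sub_conj_mul_ne_zero hz hw
  have h2 := one_sub_conj_mul_ne_zero hz hz.le
  have h3 : 1 - conj z * ((z - w) / (1 - conj z * w)) = (1 - conj z * z) / (1 - conj z * w) := by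
    rw [eq_div_iff h, sub_mul, mul_assoc, div_mul_cancel₀ _ h]
    ring
  have h4 : z - (z - w) / (1 - conj z * w) = (1 - conj z * z) * w / (1 - conj z * w) := by
    rw [eq_div_iff h, sub_mul, div_mul_cancel₀ _ h]
    ring
  rw [mobius, mobius, h3, h4, div_div_div_cancel_right₀ h, mul_div_cancel_left₀ _ h2]

@[simp]
lemma mobius_zero_right (z : ℂ) : mobius z 0 = z := by simp [mobius]

lemma hasDerivAt_mobius {z w : ℂ} (hz : ‖z‖ < 1) (hw : ‖w‖ < 1) :
    HasDerivAt (mobius z) (-(1 - conj z * z) / (1 - conj z * w) ^ 2) w := by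
  have h := one_sub_conj_mul_ne_zero hz hw.le
  have h1 : HasDerivAt (fun w : ℂ => z - w) (-1) w := by
    simpa using (hasDerivAt_id w).const_sub z
  have h2 : HasDerivAt (fun w : ℂ => 1 - conj z * w) (-conj z) w := by
    simpa using ((hasDerivAt_id w).const_mul (conj z)).const_sub 1
  refine (h1.div h2 h).congr_deriv ?_
  congr 1
  ring

lemma norm_deriv_mobius {z : ℂ} (hz : ‖z‖ < 1) (w : ℂ) :
    ‖-(1 - conj z * z) / (1 - conj z * w) ^ 2‖ = mobiusScale z w := by
  have : (1 : ℂ) - conj z * z = ((1 - ‖z‖ ^ 2 : ℝ) : ℂ) := by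
    rw [Complex.conj_mul']; push_cast; rfl
  rw [norm_div, norm_neg, this, Complex.norm_real, norm_pow, mobiusScale,
    Real.norm_of_nonneg (by nlinarith [norm_nonneg z])]

lemma mapsTo_mobius {z : ℂ} (hz : z ∈ ball (0 : ℂ) 1) : MapsTo (mobius z) (ball 0 1) (ball 0 1) :=
  fun w hw => by
    rw [mem_ball_zero_iff] at *
    exact norm_mobius_lt_one hz hw

lemma differentiableOn_mobius {z : ℂ} (hz : z ∈ ball (0 : ℂ) 1) :
    DifferentiableOn ℂ (mobius z) (ball 0 1) := fun _ hw =>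
  (hasDerivAt_mobius (mem_ball_zero_iff.mp hz)
    (mem_ball_zero_iff.mp hw)).differentiableAt.differentiableWithinAt

lemma injOn_mobius {z : ℂ} (hz : z ∈ ball (0 : ℂ) 1) : InjOn (mobius z) (ball 0 1) :=
  LeftInvOn.injOn (f₁' := mobius z) fun _ hw =>
    mobius_mobius (mem_ball_zero_iff.mp hz) (mem_ball_zero_iff.mp hw).le

/-- Change of variables `u = φ_z(w)`. -/
lemma lintegral_image_mobius {z : ℂ} (hz : z ∈ ball (0 : ℂ) 1) {s : Set ℂ} (hs : MeasurableSet s)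
    (hs1 : s ⊆ ball 0 1) (F : ℂ → ℝ≥0∞) :
    ∫⁻ u in mobius z '' s, F u =
      ∫⁻ w in s, ENNReal.ofReal (mobiusScale z w ^ 2) * F (mobius z w) := by
  have hz' := mem_ball_zero_iff.mp hz
  rw [lintegral_image_eq_lintegral_abs_det_fderiv_mul volume hs
    (fun w hw => ((hasDerivAt_mobius hz'
      (mem_ball_zero_iff.mp (hs1 hw))).hasFDerivAt.restrictScalars ℝ).hasFDerivWithinAt)
    ((injOn_mobius hz).mono hs1)]
  refine setLIntegral_congr_fun hs fun w hw => ?_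
  congr 2
  rw [← norm_deriv_mobius hz' w, ← Complex.normSq_eq_norm_sq]
  simp [ContinuousLinearMap.det, LinearMap.det_restrictScalars]
  rw [Algebra.norm_complex_apply, abs_of_nonneg (Complex.normSq_nonneg _)]
  simp

lemma image_mobius_ball {z : ℂ} (hz : z ∈ ball (0 : ℂ) 1) : mobius z '' ball 0 1 = ball 0 1 :=
  Subset.antisymm (mapsTo_mobius hz).image_subset fun w hw => ⟨mobius z w, mapsTo_mobius hz hw,
    mobius_mobius (mem_ball_zero_iff.mp hz) (mem_ball_zero_iff.mp hw).le⟩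

lemma lintegral_comp_mobius {z : ℂ} (hz : z ∈ ball (0 : ℂ) 1) (F : ℂ → ℝ≥0∞) :
    ∫⁻ w in ball (0 : ℂ) 1, ENNReal.ofReal (mobiusScale z w ^ 2) * F (mobius z w) =
      ∫⁻ u in ball (0 : ℂ) 1, F u := by
  rw [← lintegral_image_mobius hz measurableSet_ball subset_rfl, image_mobius_ball hz]

lemma mobiusScale_mobius_mul {z w : ℂ} (hz : z ∈ ball (0 : ℂ) 1) (hw : w ∈ ball (0 : ℂ) 1) :
    mobiusScale z (mobius z w) * mobiusScale z w = 1 := by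
  have hz' := mem_ball_zero_iff.mp hz
  have hw' := mem_ball_zero_iff.mp hw
  have hm := norm_mobius_lt_one hz' hw'
  have h1 := one_sub_sq_norm_mobius hz' hw'.le
  have h2 := one_sub_sq_norm_mobius hz' hm.le
  rw [mobius_mobius hz' hw'.le, h1] at h2
  have h3 : 1 - ‖w‖ ^ 2 ≠ 0 := by nlinarith [norm_nonneg w]
  apply mul_right_cancel₀ h3
  linarith

/-- Change of variables in the other direction, as `φ_z` is an involution. -/
lemma lintegral_mobius_comp {z : ℂ} (hz : z ∈ ball (0 : ℂ) 1) (F : ℂ → ℝ≥0∞) :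
    ∫⁻ w in ball (0 : ℂ) 1, F (mobius z w) =
      ∫⁻ u in ball (0 : ℂ) 1, ENNReal.ofReal (mobiusScale z u ^ 2) * F u := by
  rw [← lintegral_comp_mobius hz (fun u => ENNReal.ofReal (mobiusScale z u ^ 2) * F u)]
  refine setLIntegral_congr_fun measurableSet_ball fun w hw => ?_
  have := mobiusScale_mobius_mul hz hw
  rw [← mul_assoc, ← ENNReal.ofReal_mul (by positivity), ← mul_pow, mul_comm (mobiusScale z w),
    this]
  simp

/-- The pseudo-hyperbolic radius `tanh (r / 2)` of a Bergman ball of radius `r`: `d(z, w) < r` means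
`|φ_z(w)| < tanh (r / 2)`. -/
noncomputable def pseudoRadius (r : ℝ) : ℝ := (Real.exp r - 1) / (Real.exp r + 1)

lemma pseudoRadius_pos {r : ℝ} (hr : 0 < r) : 0 < pseudoRadius r :=
  div_pos (by linarith [Real.add_one_lt_exp hr.ne']) (by positivity)

lemma pseudoRadius_lt_one (r : ℝ) : pseudoRadius r < 1 := by
  rw [pseudoRadius, div_lt_one (by positivity)]
  linarith

lemma bergmanBall_eq_image {z : ℂ} (hz : z ∈ ball (0 : ℂ) 1) (r : ℝ) :
    bergmanBall z r = mobius z '' ball 0 (pseudoRadius r) := by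
  have hz' := mem_ball_zero_iff.mp hz
  have hlt := pseudoRadius_lt_one r
  have key : ∀ w ∈ ball (0 : ℂ) 1, bergmanDist z w < r ↔ ‖mobius z w‖ < pseudoRadius r := by
    intro w hw
    have hm := norm_mobius_lt_one hz' (mem_ball_zero_iff.mp hw)
    have h0 := norm_nonneg (mobius z w)
    rw [bergmanDist, Real.log_lt_iff_lt_exp (div_pos (by linarith) (by linarith)), pseudoRadius,
      div_lt_iff₀ (by linarith), lt_div_iff₀ (by positivity)]
    constructor <;> intro h <;> nlinarith
  ext w
  constructor
  · rintro ⟨hw, h⟩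
    exact ⟨mobius z w, mem_ball_zero_iff.mpr ((key w hw).mp h),
      mobius_mobius hz' (mem_ball_zero_iff.mp hw).le⟩
  · rintro ⟨u, hu, rfl⟩
    have hu' := mem_ball_zero_iff.mp hu
    have hmem := mapsTo_mobius hz (mem_ball_zero_iff.mpr (hu'.trans hlt))
    refine ⟨hmem, (key _ hmem).mpr ?_⟩
    rwa [mobius_mobius hz' (hu'.trans hlt).le]

lemma le_mobiusScale {z w : ℂ} (hz : ‖z‖ < 1) (hw : ‖w‖ ≤ 1) :
    (1 - ‖z‖ ^ 2) / 4 ≤ mobiusScale z w := by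
  have h := one_sub_conj_mul_ne_zero hz hw
  have h1 : ‖1 - conj z * w‖ ≤ 2 := by
    refine (norm_sub_le _ _).trans ?_
    rw [norm_one, norm_mul, RCLike.norm_conj]
    nlinarith [norm_nonneg z, norm_nonneg w]
  rw [mobiusScale]
  have h2 : 0 ≤ 1 - ‖z‖ ^ 2 := by nlinarith [norm_nonneg z]
  gcongr
  nlinarith [norm_nonneg (1 - conj z * w)]

lemma mobiusScale_le {z w : ℂ} {s : ℝ} (hz : ‖z‖ < 1) (hw : ‖w‖ ≤ s) (hs : s < 1) :
    mobiusScale z w ≤ (1 - ‖z‖ ^ 2) / (1 - s) ^ 2 := by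
  have h1 : 1 - s ≤ ‖1 - conj z * w‖ := by
    have := norm_sub_norm_le 1 (conj z * w)
    rw [norm_one, norm_mul, RCLike.norm_conj] at this
    nlinarith [norm_nonneg z, norm_nonneg w]
  rw [mobiusScale]
  have h2 : 0 ≤ 1 - ‖z‖ ^ 2 := by nlinarith [norm_nonneg z]
  have h3 : 0 < 1 - s := by linarith
  gcongr

/-! ### The mean value property of the Poisson integral -/

/-- Conformal invariance of the mean value property: the Poisson kernel is the real part of a
holomorphic function of `z`, hence so is its composition with `φ_u`, and `φ_u(0) = u`. -/
lemma circleAverage_poissonKernel_comp_mobius {ζ u : ℂ} (hζ : ‖ζ‖ = 1)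
    (hu : u ∈ ball (0 : ℂ) 1) {ρ : ℝ} (hρ : ρ ∈ Ioo 0 1) :
    Real.circleAverage (fun w => poissonKernel 0 (mobius u w) ζ) 0 ρ = poissonKernel 0 u ζ := by
  have hH : DifferentiableOn ℂ (fun w => (ζ + mobius u w) / (ζ - mobius u w)) (ball 0 1) := by
    refine DifferentiableOn.div ((differentiableOn_const ζ).add (differentiableOn_mobius hu))
      ((differentiableOn_const ζ).sub (differentiableOn_mobius hu)) fun w hw h => ?_
    have := mem_ball_zero_iff.mp (mapsTo_mobius hu hw)
    rw [← sub_eq_zero.mp h, hζ] at this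
    exact lt_irrefl _ this
  have hcl : closedBall (0 : ℂ) |ρ| ⊆ ball 0 1 := by
    rw [abs_of_pos hρ.1]
    exact closedBall_subset_ball hρ.2
  have hd : DiffContOnCl ℂ (fun w => (ζ + mobius u w) / (ζ - mobius u w)) (ball 0 |ρ|) :=
    (hH.mono (closure_ball_subset_closedBall.trans hcl)).diffContOnCl
  have hci : CircleIntegrable (fun w => (ζ + mobius u w) / (ζ - mobius u w)) 0 ρ :=
    ContinuousOn.circleIntegrable' (hH.continuousOn.mono (sphere_subset_closedBall.trans hcl))
  have h1 := Complex.reCLM.circleAverage_comp_comm hci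
  rw [hd.circleAverage] at h1
  have h2 : ∀ v, poissonKernel 0 v ζ = ((ζ + v) / (ζ - v)).re := fun v => by
    rw [poissonKernel_eq_re_herglotzRieszKernel, Function.comp_apply, herglotzRieszKernel_def]
    simp
  simp_rw [h2]
  simpa [Function.comp_def] using h1

lemma lintegral_poissonKernel_comp_mobius {ζ u : ℂ} (hζ : ‖ζ‖ = 1) (hu : u ∈ ball (0 : ℂ) 1) :
    ∫⁻ w in ball (0 : ℂ) 1,
        ENNReal.ofReal ((1 - ‖mobius u w‖ ^ 2) / ‖ζ - mobius u w‖ ^ 2) =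
      ENNReal.ofReal π * ENNReal.ofReal ((1 - ‖u‖ ^ 2) / ‖ζ - u‖ ^ 2) := by
  have hK : ∀ v, (1 - ‖v‖ ^ 2) / ‖ζ - v‖ ^ 2 = poissonKernel 0 v ζ := fun v => by
    simp [poissonKernel_def, hζ]
  simp_rw [hK]
  have hcont : ContinuousOn (fun w => poissonKernel 0 (mobius u w) ζ) (ball 0 1) := by
    simp_rw [← hK]
    have hm := (differentiableOn_mobius hu).continuousOn
    refine (continuousOn_const.sub (hm.norm.pow 2)).div ((continuousOn_const.sub hm).norm.pow 2)
      fun w hw h => ?_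
    have := mem_ball_zero_iff.mp (mapsTo_mobius hu hw)
    rw [← sub_eq_zero.mp (norm_eq_zero.mp (pow_eq_zero_iff two_ne_zero |>.mp h)), hζ] at this
    exact lt_irrefl _ this
  rw [lintegral_ball_eq_of_circle
    (F := fun w => ENNReal.ofReal (poissonKernel 0 (mobius u w) ζ))
    (m := fun _ => ENNReal.ofReal (2 * π * poissonKernel 0 u ζ))
    (ENNReal.continuous_ofReal.comp_continuousOn hcont)]
  · rw [lintegral_mul_const' _ _ (by finiteness)]
    have := lintegral_Ioo_pow zero_le_one 0
    simp only [mul_zero, zero_add, pow_one] at this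
    rw [this, ← ENNReal.ofReal_mul (by positivity), ← ENNReal.ofReal_mul (by positivity)]
    congr 1
    push_cast
    ring
  · intro ρ hρ
    have hsub : sphere (0 : ℂ) |ρ| ⊆ ball 0 1 := by
      rw [abs_of_pos hρ.1]
      exact sphere_subset_ball hρ.2
    rw [lintegral_circleMap_eq_circleAverage (hcont.mono hsub),
      circleAverage_poissonKernel_comp_mobius hζ hu hρ]
    intro w hw
    rw [← hK]
    have := one_sub_sq_norm_pos (mem_ball_zero_iff.mp (mapsTo_mobius hu (hsub hw)))
    positivity

lemma measurable_poissonIntegral (μ : Measure (sphere (0 : ℂ) 1)) [IsFiniteMeasure μ] :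
    Measurable (poissonIntegral μ) := by
  unfold poissonIntegral
  refine Measurable.div_const (Measurable.lintegral_prod_right' (f := fun p : ℂ × sphere (0 : ℂ) 1 =>
    ENNReal.ofReal ((1 - ‖p.1‖ ^ 2) / ‖(p.2 : ℂ) - p.1‖ ^ 2)) ?_) _
  fun_prop

lemma measurable_mobius_uncurry : Measurable fun p : ℂ × ℂ => mobius p.1 p.2 := by
  unfold mobius
  have : Measurable fun p : ℂ × ℂ => conj p.1 :=
    (Complex.continuous_conj.comp continuous_fst).measurable
  fun_prop

lemma lintegral_poissonIntegral_comp_mobius (μ : Measure (sphere (0 : ℂ) 1)) [IsFiniteMeasure μ]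
    {u : ℂ} (hu : u ∈ ball (0 : ℂ) 1) :
    ∫⁻ w in ball (0 : ℂ) 1, poissonIntegral μ (mobius u w) =
      ENNReal.ofReal π * poissonIntegral μ u := by
  have hpi : ENNReal.ofReal (2 * π) ≠ 0 := by
    rw [Ne, ENNReal.ofReal_eq_zero, not_le]
    positivity
  simp_rw [poissonIntegral, div_eq_mul_inv]
  rw [lintegral_mul_const' _ _ (by finiteness), lintegral_lintegral_swap, ← mul_assoc]
  · congr 1
    rw [← lintegral_const_mul' _ _ (by finiteness)]
    refine lintegral_congr fun ζ => ?_
    have := lintegral_poissonKernel_comp_mobius (ζ := (ζ : ℂ)) (by simp) hu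
    simpa only [div_eq_mul_inv] using this
  · have hm : Measurable fun p : ℂ × sphere (0 : ℂ) 1 => mobius u p.1 :=
      measurable_mobius_uncurry.comp (measurable_const.prodMk measurable_fst)
    refine Measurable.aemeasurable ?_
    unfold Function.uncurry
    fun_prop

/-! ### The global mean oscillation -/

/-- No measurability of `G` is needed, as the density of `τ` is finite everywhere: the mean
oscillations are thus integrated without a discussion of their measurability in `z`. -/
lemma lintegral_diskTau (G : ℂ → ℝ≥0∞) :
    ∫⁻ z, G z ∂diskTau =
      ∫⁻ z in ball (0 : ℂ) 1, ENNReal.ofReal (1 / (1 - ‖z‖ ^ 2) ^ 2) * G z := by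
  rw [diskTau, lintegral_withDensity_eq_lintegral_mul_non_measurable _ (by fun_prop)
    (by simp)]
  rfl

lemma sqrt_pow_two (x : ℝ≥0∞) : (x ^ (1 / 2 : ℝ)) ^ 2 = x := by
  rw [← ENNReal.rpow_natCast, ← ENNReal.rpow_mul]
  norm_num

lemma differentiableOn_comp_mobius {f : ℂ → ℂ} (hf : DifferentiableOn ℂ f (ball 0 1)) {z : ℂ}
    (hz : z ∈ ball (0 : ℂ) 1) : DifferentiableOn ℂ (fun w => f (mobius z w)) (ball 0 1) :=
  hf.comp (differentiableOn_mobius hz) (mapsTo_mobius hz)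

lemma enorm_deriv_comp_mobius {f : ℂ → ℂ} (hf : DifferentiableOn ℂ f (ball 0 1)) {z w : ℂ}
    (hz : z ∈ ball (0 : ℂ) 1) (hw : w ∈ ball (0 : ℂ) 1) :
    ‖deriv (fun w => f (mobius z w)) w‖ₑ ^ 2 =
      ENNReal.ofReal (mobiusScale z w ^ 2) * ‖deriv f (mobius z w)‖ₑ ^ 2 := by
  have h1 : HasDerivAt f (deriv f (mobius z w)) (mobius z w) :=
    (hf.differentiableAt (isOpen_ball.mem_nhds (mapsTo_mobius hz hw))).hasDerivAt
  have h2 := hasDerivAt_mobius (mem_ball_zero_iff.mp hz) (mem_ball_zero_iff.mp hw)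
  have h3 := (h1.comp w h2).deriv
  rw [Function.comp_def] at h3
  have hpos := mobiusScale_pos (mem_ball_zero_iff.mp hz) (mem_ball_zero_iff.mp hw).le
  rw [h3, enorm_mul, mul_pow, mul_comm, ENNReal.ofReal_pow hpos.le,
    ← norm_deriv_mobius (mem_ball_zero_iff.mp hz), ofReal_norm]

/-- The Littlewood–Paley inequality for `f ∘ φ_z`, with the right-hand side transported by `φ_z`. -/
lemma meanOsc_sq_le {f : ℂ → ℂ} (hf : DifferentiableOn ℂ f (ball 0 1)) {z : ℂ}
    (hz : z ∈ ball (0 : ℂ) 1) :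
    meanOsc f z ^ 2 ≤ ENNReal.ofReal (3 / 2) * ∫⁻ u in ball (0 : ℂ) 1,
      ‖deriv f u‖ₑ ^ 2 * ENNReal.ofReal ((1 - ‖mobius z u‖ ^ 2) ^ 2) := by
  have h := lintegral_sq_enorm_sub_le (differentiableOn_comp_mobius hf hz)
  rw [mobius_zero_right] at h
  rw [meanOsc, sqrt_pow_two, diskArea]
  refine h.trans (le_of_eq ?_)
  rw [← lintegral_comp_mobius hz
    (fun u => ‖deriv f u‖ₑ ^ 2 * ENNReal.ofReal ((1 - ‖mobius z u‖ ^ 2) ^ 2))]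
  congr 1
  refine setLIntegral_congr_fun measurableSet_ball fun w hw => ?_
  simp only [enorm_deriv_comp_mobius hf hz hw,
    mobius_mobius (mem_ball_zero_iff.mp hz) (mem_ball_zero_iff.mp hw).le]
  ring

/-- The factor `(1 - |φ_z(u)|²)²` cancels the density of `dτ` and leaves the Jacobian of `φ_u`. -/
lemma lintegral_one_sub_sq_norm_mobius_mul_poissonIntegral (μ : Measure (sphere (0 : ℂ) 1))
    [IsFiniteMeasure μ] {u : ℂ} (hu : u ∈ ball (0 : ℂ) 1) :
    ∫⁻ z in ball (0 : ℂ) 1, ENNReal.ofReal (1 / (1 - ‖z‖ ^ 2) ^ 2) *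
        (ENNReal.ofReal ((1 - ‖mobius z u‖ ^ 2) ^ 2) * poissonIntegral μ z) =
      ENNReal.ofReal π * poissonIntegral μ u := by
  rw [← lintegral_poissonIntegral_comp_mobius μ hu, lintegral_mobius_comp hu]
  refine setLIntegral_congr_fun measurableSet_ball fun z hz => ?_
  have hz' := mem_ball_zero_iff.mp hz
  have h0 := one_sub_sq_norm_pos hz'
  rw [← mul_assoc, ← ENNReal.ofReal_mul (by positivity), norm_mobius_comm,
    one_sub_sq_norm_mobius (mem_ball_zero_iff.mp hu) hz'.le]
  congr 2
  field_simp

lemma lintegral_meanOsc_le (μ : Measure (sphere (0 : ℂ) 1)) [IsFiniteMeasure μ] {f : ℂ → ℂ}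
    (hf : DifferentiableOn ℂ f (ball 0 1)) :
    ∫⁻ z, meanOsc f z ^ 2 * poissonIntegral μ z ∂diskTau ≤
      ENNReal.ofReal (3 / 2) * (ENNReal.ofReal π *
        ∫⁻ z, ‖deriv f z‖ₑ ^ 2 * poissonIntegral μ z ∂diskArea) := by
  have hP := measurable_poissonIntegral μ
  have hd := measurable_deriv f
  have hm := measurable_mobius_uncurry
  have hW : Measurable fun z : ℂ => ENNReal.ofReal (1 / (1 - ‖z‖ ^ 2) ^ 2) := by fun_prop
  have hm' : ∀ z, Measurable (mobius z) := fun z => hm.comp measurable_prodMk_left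
  calc ∫⁻ z, meanOsc f z ^ 2 * poissonIntegral μ z ∂diskTau
      ≤ ∫⁻ z in ball (0 : ℂ) 1, ENNReal.ofReal (3 / 2) * ∫⁻ u in ball (0 : ℂ) 1,
          ‖deriv f u‖ₑ ^ 2 * (ENNReal.ofReal (1 / (1 - ‖z‖ ^ 2) ^ 2) *
            (ENNReal.ofReal ((1 - ‖mobius z u‖ ^ 2) ^ 2) * poissonIntegral μ z)) := by
        rw [lintegral_diskTau]
        refine setLIntegral_mono' measurableSet_ball fun z hz => ?_
        refine (mul_le_mul_right (mul_le_mul_left (meanOsc_sq_le hf hz) _) _).trans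
          (le_of_eq ?_)
        rw [mul_assoc, mul_left_comm]
        congr 1
        rw [← lintegral_mul_const _ (by have := hm' z; fun_prop),
          ← lintegral_const_mul _ (by have := hm' z; fun_prop)]
        refine lintegral_congr fun u => ?_
        ring
    _ = ENNReal.ofReal (3 / 2) * ∫⁻ u in ball (0 : ℂ) 1, ∫⁻ z in ball (0 : ℂ) 1,
          ‖deriv f u‖ₑ ^ 2 * (ENNReal.ofReal (1 / (1 - ‖z‖ ^ 2) ^ 2) *
            (ENNReal.ofReal ((1 - ‖mobius z u‖ ^ 2) ^ 2) * poissonIntegral μ z)) := by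
        rw [lintegral_const_mul' _ _ (by finiteness), lintegral_lintegral_swap]
        unfold Function.uncurry
        fun_prop
    _ = ENNReal.ofReal (3 / 2) * (ENNReal.ofReal π *
          ∫⁻ z, ‖deriv f z‖ₑ ^ 2 * poissonIntegral μ z ∂diskArea) := by
        congr 1
        rw [← lintegral_const_mul' _ _ (by finiteness), diskArea]
        refine setLIntegral_congr_fun measurableSet_ball fun u hu => ?_
        rw [lintegral_const_mul' _ _ (by finiteness),
          lintegral_one_sub_sq_norm_mobius_mul_poissonIntegral μ hu]
        ring

/-! ### The mean oscillation on Bergman balls -/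

/-- On `φ_z(B(0, s))` the Jacobian of `φ_z` is constant up to the factor `16 / (1 - s)⁴`, uniformly
in `z`. Averages over this set and averages of the pulled back function over `B(0, s)` are therefore
comparable. -/
lemma lintegral_image_mobius_div_volume {z : ℂ} (hz : z ∈ ball (0 : ℂ) 1) {s : ℝ} (hs0 : 0 < s)
    (hs : s < 1) (F : ℂ → ℝ≥0∞) :
    (∫⁻ u in mobius z '' ball 0 s, F u) / volume (mobius z '' ball 0 s) ≤
        ENNReal.ofReal (16 / (1 - s) ^ 4) *
          ((∫⁻ w in ball (0 : ℂ) s, F (mobius z w)) / volume (ball (0 : ℂ) s)) ∧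
      (∫⁻ w in ball (0 : ℂ) s, F (mobius z w)) / volume (ball (0 : ℂ) s) ≤
        ENNReal.ofReal (16 / (1 - s) ^ 4) *
          ((∫⁻ u in mobius z '' ball 0 s, F u) / volume (mobius z '' ball 0 s)) := by
  have hz' := mem_ball_zero_iff.mp hz
  have hsub : ball (0 : ℂ) s ⊆ ball 0 1 := ball_subset_ball hs.le
  have hq := one_sub_sq_norm_pos hz'
  have hs1 : 0 < 1 - s := by linarith
  -- `a` and `b` are the bounds of `le_mobiusScale` and `mobiusScale_le` for the Jacobian of `φ_z`.
  set a : ℝ := ((1 - ‖z‖ ^ 2) / 4) ^ 2 with ha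
  set b : ℝ := ((1 - ‖z‖ ^ 2) / (1 - s) ^ 2) ^ 2 with hb
  have ha0 : 0 < a := by positivity
  have hb0 : 0 < b := by positivity
  have hab : 16 / (1 - s) ^ 4 = b / a := by
    rw [ha, hb]
    field_simp
    norm_num
  have key : ∀ G : ℂ → ℝ≥0∞,
      ENNReal.ofReal a * ∫⁻ w in ball (0 : ℂ) s, G (mobius z w) ≤
        ∫⁻ u in mobius z '' ball 0 s, G u ∧
      ∫⁻ u in mobius z '' ball 0 s, G u ≤
        ENNReal.ofReal b * ∫⁻ w in ball (0 : ℂ) s, G (mobius z w) := by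
    intro G
    rw [lintegral_image_mobius hz measurableSet_ball hsub,
      ← lintegral_const_mul' _ _ (by finiteness), ← lintegral_const_mul' _ _ (by finiteness)]
    refine ⟨setLIntegral_mono' measurableSet_ball fun w hw => ?_,
      setLIntegral_mono' measurableSet_ball fun w hw => ?_⟩
    · have h := le_mobiusScale hz' (mem_ball_zero_iff.mp (hsub hw)).le
      rw [ha]
      gcongr
    · have h := mobiusScale_le hz' (mem_ball_zero_iff.mp hw).le hs
      have h0 := mobiusScale_pos hz' (mem_ball_zero_iff.mp (hsub hw)).le
      rw [hb]
      gcongr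
  -- The constant function `1` gives the bounds for the volumes.
  have hvol := key fun _ => 1
  simp only [lintegral_const, one_mul, Measure.restrict_apply MeasurableSet.univ, univ_inter]
    at hvol
  have hF := key F
  set V := volume (ball (0 : ℂ) s)
  set B := volume (mobius z '' ball (0 : ℂ) s)
  set I := ∫⁻ w in ball (0 : ℂ) s, F (mobius z w)
  set J := ∫⁻ u in mobius z '' ball 0 s, F u
  have hV0 : V ≠ 0 := (measure_ball_pos volume _ hs0).ne'
  have hVt : V ≠ ∞ := measure_ball_lt_top.ne
  have hA0 : ENNReal.ofReal a ≠ 0 := (ENNReal.ofReal_pos.mpr ha0).ne'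
  have hB0 : ENNReal.ofReal b ≠ 0 := (ENNReal.ofReal_pos.mpr hb0).ne'
  rw [hab, ENNReal.ofReal_div_of_pos ha0]
  have hcalc : ∀ α β x y : ℝ≥0∞, β ≠ 0 → β ≠ ∞ → α / β * (x / y) = α * x / (β * y) := by
    intro α β x y h1 h2
    rw [div_eq_mul_inv, div_eq_mul_inv, div_eq_mul_inv, ENNReal.mul_inv (Or.inl h1) (Or.inl h2)]
    ring
  constructor
  · rw [hcalc _ _ _ _ hA0 (by finiteness)]
    exact ENNReal.div_le_div hF.2 hvol.1
  · have hc : I / V = ENNReal.ofReal b * (ENNReal.ofReal a * I) /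
        (ENNReal.ofReal a * (ENNReal.ofReal b * V)) := by
      rw [← ENNReal.mul_div_mul_left I V (mul_ne_zero hA0 hB0) (by finiteness)]
      congr 1 <;> ring
    rw [hcalc _ _ _ _ hA0 (by finiteness), hc]
    exact ENNReal.div_le_div (mul_le_mul_right hF.1 _) (mul_le_mul_right hvol.2 _)

/-- The mean minimises the mean square deviation up to a constant. Integrability of `f` is not needed:
if the right-hand side is finite, then `f` is square integrable. -/
lemma lintegral_sq_enorm_sub_integral_le {α : Type*} [MeasurableSpace α] (ν : Measure α)
    [IsProbabilityMeasure ν] {f : α → ℂ} (hf : AEStronglyMeasurable f ν) (c : ℂ) :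
    ∫⁻ x, ‖f x - ∫ y, f y ∂ν‖ₑ ^ 2 ∂ν ≤ 4 * ∫⁻ x, ‖f x - c‖ₑ ^ 2 ∂ν := by
  have hsq : ∀ g : α → ℂ, ∫⁻ x, ‖g x‖ₑ ^ 2 ∂ν = eLpNorm g 2 ν ^ 2 := by
    intro g
    have := eLpNorm_nnreal_pow_eq_lintegral (f := g) (μ := ν) (p := 2) two_ne_zero
    simpa using this.symm
  have hm : AEStronglyMeasurable (fun x => f x - c) ν := hf.sub aestronglyMeasurable_const
  rw [hsq fun x => f x - c, hsq fun x => f x - ∫ y, f y ∂ν]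
  by_cases htop : eLpNorm (fun x => f x - c) 2 ν = ∞
  · simp [htop]
  have hLp : MemLp (fun x => f x - c) 2 ν := ⟨hm, lt_top_iff_ne_top.mpr htop⟩
  have hint : Integrable (fun x => f x - c) ν := hLp.integrable one_le_two
  have hintf : Integrable f ν := 
    (hint.add (integrable_const c)).congr (ae_of_all _ fun x => by simp)
  set A := ∫ y, f y ∂ν with hA
  have h1 : ‖c - A‖ₑ ≤ eLpNorm (fun x => f x - c) 2 ν := by
    have h2 : A - c = ∫ x, (f x - c) ∂ν := by
      rw [integral_sub hintf (integrable_const c)]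
      simp [hA]
    rw [← enorm_neg, neg_sub, h2]
    refine (enorm_integral_le_lintegral_enorm _).trans ?_
    rw [← eLpNorm_one_eq_lintegral_enorm]
    exact eLpNorm_le_eLpNorm_of_exponent_le one_le_two hm
  have h3 : eLpNorm (fun x => f x - A) 2 ν ≤ 2 * eLpNorm (fun x => f x - c) 2 ν := by
    have h4 : (fun x => f x - A) = (fun x => f x - c) + fun _ => c - A := by
      funext x
      simp
    rw [h4, two_mul]
    refine (eLpNorm_add_le hm aestronglyMeasurable_const one_le_two).trans ?_
    gcongr
    rw [eLpNorm_const _ two_ne_zero (IsProbabilityMeasure.ne_zero ν)]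
    simpa using h1
  calc _ ≤ (2 * eLpNorm (fun x => f x - c) 2 ν) ^ 2 := by gcongr
    _ = _ := by rw [mul_pow]; norm_num

lemma meanOscBall_sq (r : ℝ) (f : ℂ → ℂ) (z : ℂ) :
    meanOscBall r f z ^ 2 =
      (∫⁻ w in bergmanBall z r, ‖f w - ballAverage r f z‖ₑ ^ 2) / volume (bergmanBall z r) := by
  rw [meanOscBall, sqrt_pow_two]

lemma bergmanBall_subset (z : ℂ) (r : ℝ) : bergmanBall z r ⊆ ball 0 1 := fun _ h => h.1

lemma volume_bergmanBall_ne_top (z : ℂ) (r : ℝ) : volume (bergmanBall z r) ≠ ∞ :=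
  ((measure_mono (bergmanBall_subset z r)).trans_lt measure_ball_lt_top).ne

lemma isOpen_bergmanBall {z : ℂ} (hz : z ∈ ball (0 : ℂ) 1) (r : ℝ) :
    IsOpen (bergmanBall z r) := by
  have h : bergmanBall z r = ball 0 1 ∩ mobius z ⁻¹' ball 0 (pseudoRadius r) := by
    have hlt := (pseudoRadius_lt_one r).le
    rw [bergmanBall_eq_image hz]
    ext w
    constructor
    · rintro ⟨u, hu, rfl⟩
      have hu1 := ball_subset_ball hlt hu
      refine ⟨mapsTo_mobius hz hu1, ?_⟩
      rwa [mem_preimage, mobius_mobius (mem_ball_zero_iff.mp hz) (mem_ball_zero_iff.mp hu1).le]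
    · rintro ⟨hw, h⟩
      exact ⟨_, h, mobius_mobius (mem_ball_zero_iff.mp hz) (mem_ball_zero_iff.mp hw).le⟩
  rw [h]
  exact (differentiableOn_mobius hz).continuousOn.isOpen_inter_preimage isOpen_ball isOpen_ball

lemma volume_bergmanBall_ne_zero {z : ℂ} (hz : z ∈ ball (0 : ℂ) 1) {r : ℝ} (hr : 0 < r) :
    volume (bergmanBall z r) ≠ 0 := by
  refine (isOpen_bergmanBall hz r).measure_ne_zero _ ⟨z, ?_⟩
  rw [bergmanBall_eq_image hz]
  exact ⟨0, mem_ball_self (pseudoRadius_pos hr), mobius_zero_right z⟩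

lemma meanOscBall_sq_le_average {f : ℂ → ℂ} (hf : ContinuousOn f (ball 0 1)) {z : ℂ}
    (hz : z ∈ ball (0 : ℂ) 1) {r : ℝ} (hr : 0 < r) (c : ℂ) :
    meanOscBall r f z ^ 2 ≤
      4 * ((∫⁻ w in bergmanBall z r, ‖f w - c‖ₑ ^ 2) / volume (bergmanBall z r)) := by
  set B := bergmanBall z r with hB
  have hB0 : volume B ≠ 0 := volume_bergmanBall_ne_zero hz hr
  have hBt : volume B ≠ ∞ := volume_bergmanBall_ne_top z r
  have hprob : IsProbabilityMeasure ((volume B)⁻¹ • volume.restrict B) := by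
    constructor
    simp [ENNReal.inv_mul_cancel hB0 hBt]
  have hm : AEStronglyMeasurable f ((volume B)⁻¹ • volume.restrict B) :=
    ((hf.mono (bergmanBall_subset z r)).aestronglyMeasurable
      (isOpen_bergmanBall hz r).measurableSet).smul_measure _
  have h := lintegral_sq_enorm_sub_integral_le _ hm c
  have havg : ∫ y, f y ∂((volume B)⁻¹ • volume.restrict B) = ballAverage r f z := by
    rw [ballAverage, average, Measure.restrict_apply_univ]
  rw [havg, lintegral_smul_measure, lintegral_smul_measure, smul_eq_mul, smul_eq_mul] at h
  rw [meanOscBall_sq, div_eq_mul_inv, div_eq_mul_inv, mul_comm, mul_comm (lintegral _ _)]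
  exact h

lemma meanOscBall_sq_le_meanOsc_sq {f : ℂ → ℂ} (hf : ContinuousOn f (ball 0 1)) {z : ℂ}
    (hz : z ∈ ball (0 : ℂ) 1) {r : ℝ} (hr : 0 < r) :
    meanOscBall r f z ^ 2 ≤ 4 * (ENNReal.ofReal (16 / (1 - pseudoRadius r) ^ 4) *
      (volume (ball (0 : ℂ) (pseudoRadius r)))⁻¹) * meanOsc f z ^ 2 := by
  have hs0 := pseudoRadius_pos hr
  have hs1 := pseudoRadius_lt_one r
  refine (meanOscBall_sq_le_average hf hz hr (f z)).trans ?_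
  rw [mul_assoc]
  gcongr
  rw [bergmanBall_eq_image hz]
  refine (lintegral_image_mobius_div_volume hz hs0 hs1 _).1.trans ?_
  rw [meanOsc, sqrt_pow_two, diskArea, mul_assoc, mul_comm (volume _)⁻¹, ← div_eq_mul_inv]
  gcongr

/-- The derivative of `f ∘ φ_z` at `0` has absolute value `(1 - |z|²) |f'(z)|`, and the mean square
oscillation of `f ∘ φ_z` on a disk around `0` controls it. -/
lemma sq_enorm_deriv_le_meanOscBall_sq {f : ℂ → ℂ} (hf : DifferentiableOn ℂ f (ball 0 1)) {z : ℂ}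
    (hz : z ∈ ball (0 : ℂ) 1) {r : ℝ} (hr : 0 < r) :
    ENNReal.ofReal (π * pseudoRadius r ^ 4 / 2) * ‖deriv f z‖ₑ ^ 2 ≤
      ENNReal.ofReal (16 / (1 - pseudoRadius r) ^ 4) * volume (ball (0 : ℂ) (pseudoRadius r)) *
        (ENNReal.ofReal (1 / (1 - ‖z‖ ^ 2) ^ 2) * meanOscBall r f z ^ 2) := by
  have hs0 := pseudoRadius_pos hr
  have hs1 := pseudoRadius_lt_one r
  have hq := one_sub_sq_norm_pos (mem_ball_zero_iff.mp hz)
  set s := pseudoRadius r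
  have h1 := sq_enorm_deriv_zero_le (differentiableOn_comp_mobius hf hz) (ballAverage r f z)
    hs0.le hs1.le
  rw [enorm_deriv_comp_mobius hf hz (mem_ball_self one_pos), mobius_zero_right] at h1
  have hV0 : volume (ball (0 : ℂ) s) ≠ 0 := (measure_ball_pos volume _ hs0).ne'
  have hVt : volume (ball (0 : ℂ) s) ≠ ∞ := measure_ball_lt_top.ne
  have h2 := (lintegral_image_mobius_div_volume hz hs0 hs1
    fun w => ‖f w - ballAverage r f z‖ₑ ^ 2).2
  rw [← bergmanBall_eq_image hz, ← meanOscBall_sq, ENNReal.div_le_iff hV0 hVt] at h2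
  have h3 : mobiusScale z 0 = 1 - ‖z‖ ^ 2 := by simp [mobiusScale]
  rw [h3] at h1
  have h4 : ENNReal.ofReal (1 / (1 - ‖z‖ ^ 2) ^ 2) * ENNReal.ofReal ((1 - ‖z‖ ^ 2) ^ 2) = 1 := by
    rw [← ENNReal.ofReal_mul (by positivity), one_div_mul_cancel (by positivity),
      ENNReal.ofReal_one]
  calc ENNReal.ofReal (π * s ^ 4 / 2) * ‖deriv f z‖ₑ ^ 2
      = ENNReal.ofReal (1 / (1 - ‖z‖ ^ 2) ^ 2) * (ENNReal.ofReal (π * s ^ 4 / 2) *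
          (ENNReal.ofReal ((1 - ‖z‖ ^ 2) ^ 2) * ‖deriv f z‖ₑ ^ 2)) := by
        rw [mul_left_comm, ← mul_assoc (ENNReal.ofReal (1 / _)), h4, one_mul]
    _ ≤ ENNReal.ofReal (1 / (1 - ‖z‖ ^ 2) ^ 2) * (ENNReal.ofReal (16 / (1 - s) ^ 4) *
          meanOscBall r f z ^ 2 * volume (ball (0 : ℂ) s)) := by
        exact mul_le_mul_right (h1.trans h2) _
    _ = _ := by ring

end DirichletType

/-! ### Equivalence of the three conditions -/

theorem theorem3p4 (μ : Measure (Metric.sphere (0 : ℂ) 1)) [IsFiniteMeasure μ] (hμ : μ ≠ 0)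
    (f : ℂ → ℂ) (hf : DirichletType.MemBergman f) (r : ℝ) (hr : 0 < r) :
    List.TFAE [
      DirichletType.MemDirichlet μ f,
      ∫⁻ z, DirichletType.meanOsc f z ^ 2 * DirichletType.poissonIntegral μ z
        ∂DirichletType.diskTau < ∞,
      ∫⁻ z, DirichletType.meanOscBall r f z ^ 2 * DirichletType.poissonIntegral μ z
        ∂DirichletType.diskTau < ∞] := by
  have hs0 := DirichletType.pseudoRadius_pos hr
  have hs1 := DirichletType.pseudoRadius_lt_one r
  have hV0 : volume (Metric.ball (0 : ℂ) (DirichletType.pseudoRadius r)) ≠ 0 :=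
    (Metric.measure_ball_pos volume _ hs0).ne'
  have hVt : volume (Metric.ball (0 : ℂ) (DirichletType.pseudoRadius r)) ≠ ∞ :=
    measure_ball_lt_top.ne
  tfae_have 1 → 2 := fun h =>
    (DirichletType.lintegral_meanOsc_le μ hf.1).trans_lt
      (ENNReal.mul_lt_top (by finiteness) (ENNReal.mul_lt_top (by finiteness) h.2))
  tfae_have 2 → 3 := by
    intro h
    set C : ℝ≥0∞ := 4 * (ENNReal.ofReal (16 / (1 - DirichletType.pseudoRadius r) ^ 4) *
      (volume (Metric.ball (0 : ℂ) (DirichletType.pseudoRadius r)))⁻¹) with hC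
    have hCt : C ≠ ∞ := by finiteness
    refine lt_of_le_of_lt ?_ (ENNReal.mul_lt_top hCt.lt_top h)
    rw [DirichletType.lintegral_diskTau, DirichletType.lintegral_diskTau,
      ← lintegral_const_mul' _ _ hCt]
    refine setLIntegral_mono' measurableSet_ball fun z hz => ?_
    have := DirichletType.meanOscBall_sq_le_meanOsc_sq hf.1.continuousOn hz hr
    rw [mul_left_comm C, ← mul_assoc C]
    exact mul_le_mul_right (mul_le_mul_left this _) _
  tfae_have 3 → 1 := by
    intro h
    refine ⟨hf.1, ?_⟩
    have hpos : ENNReal.ofReal (Real.pi * DirichletType.pseudoRadius r ^ 4 / 2) ≠ 0 :=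
      (ENNReal.ofReal_pos.mpr (by positivity)).ne'
    refine ENNReal.lt_top_of_mul_ne_top_right (ne_of_lt ?_) hpos
    set C : ℝ≥0∞ := ENNReal.ofReal (16 / (1 - DirichletType.pseudoRadius r) ^ 4) *
      volume (Metric.ball (0 : ℂ) (DirichletType.pseudoRadius r)) with hC
    have hCt : C ≠ ∞ := by finiteness
    refine lt_of_le_of_lt ?_ (ENNReal.mul_lt_top hCt.lt_top h)
    rw [DirichletType.lintegral_diskTau, ← lintegral_const_mul' _ _ hCt,
      ← lintegral_const_mul' _ _ (by finiteness), DirichletType.diskArea]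
    refine setLIntegral_mono' measurableSet_ball fun z hz => ?_
    have := DirichletType.sq_enorm_deriv_le_meanOscBall_sq hf.1 hz hr
    rw [← mul_assoc, ← mul_assoc (ENNReal.ofReal (1 / _)), ← mul_assoc C]
    exact mul_le_mul_left this _
  tfae_finish
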